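/- Let $\mathcal Z,\mathcal Y$ be finite-dimensional real Hilbert spaces, $\mathcal M:\mathcal Z\to\mathcal Y$ a nonzero linear map with adjoint $\mathcal M^*$, and $b\in\mathcal Y$. Let $h:\mathcal Z\to\mathbb R$ be convex and differentiable with $\|\nabla h(z_1)-\nabla h(z_2)\|\le L\|z_1-z_2\|$ for all $z_1,z_2\in\mathcal Z$, where $L>0$, and let $P:\mathcal Y\to(-\infty,\infty]$ be proper, closed and convex. Assume that the problem $$\min_{z\in\mathcal Z}\; h(z)+P(\mathcal Mz-b)\qquad\text{(P)}$$ has an optimal solution and that $(\mathrm{Range}(\mathcal M)-b)\cap\mathrm{ri}(\mathrm{dom}\,P)\ne\emptyset$, where $\mathrm{dom}\,P=\{y: P(y)<\infty\}$ and $\mathrm{ri}$ denotes the relative interior. For an extended-real-valued function $f$ write $f^*(v)=\sup_u\{\langle v,u\rangle-f(u)\}$ and $\mathrm{prox}_f(v)=\arg\min_u\{f(u)+\tfrac12\|u-v\|^2\}$. The Fenchel dual of (P) is equivalent to $$\min_{x\in\mathcal Z,\;y\in\mathcal Y}\; h^*(x)+P^*(y)+\langle b,y\rangle\quad\text{subject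 to}\quad x+\mathcal M^*y=0.\qquad\text{(D)}$$ Let $\beta\in(0,\tfrac2L)$, $\gamma\in\bigl(0,\,1+\min\{\tfrac12,\tfrac1{\beta L}-\tfrac12\}\bigr)$, $\tau\ge\beta\|\mathcal M^*\mathcal M\|$ and $\mathcal T=\tau\mathcal I-\beta\mathcal M\mathcal M^*$. Starting from an arbitrary $(y^0,z^0)\in\mathcal Y\times\mathcal Z$, let $\{(y^t,z^t)\}$ be generated by the proximal-proximal gradient (PPG) algorithm: for $t=0,1,2,\dots$, $$y^{t+1}=\mathrm{prox}_{\tau^{-1}P^*}\!\left(\frac{\mathcal Ty^t-b+\mathcal Mz^t-\beta\mathcal M\nabla h(z^t)}{\tau}\right),\qquad z^{t+1}=z^t-\gamma\beta\bigl(\nabla h(z^t)+\mathcal M^*y^{t+1}\bigr),$$ and put $x^{t+1}=\nabla h(z^t)$ for all $t\ge0$. Then $\{(x^t,y^t)\}$ converges to an optimal solution of (D), and $\{z^t\}$ converges to an optimal solution of (P). -/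

import Mathlib

open Filter Topology

noncomputable section

namespace PPG

/-- The effective domain `{z | f z < ∞}` of an extended-real-valued function. -/
def dom {E : Type*} (f : E → EReal) : Set E := {z | f z < ⊤}

/-- A proper closed convex function `f : E → (-∞, ∞]`: it never takes the value `-∞`, it is finite
somewhere, it is lower semicontinuous, and its epigraph is convex. -/
structure ProperClosedConvex {E : Type*} [NormedAddCommGroup E] [InnerProductSpace ℝ E]
    (f : E → EReal) : Prop where
  ne_bot : ∀ z, f z ≠ ⊥
  dom_nonempty : (dom f).Nonempty
  closed : LowerSemicontinuous f
  convex : Convex ℝ {p : E × ℝ | f p.1 ≤ (p.2 : EReal)}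

/-- The convex conjugate `f^*(z) = sup_u (⟨z, u⟩ - f u)`. -/
def conj {E : Type*} [NormedAddCommGroup E] [InnerProductSpace ℝ E]
    (f : E → EReal) (z : E) : EReal :=
  ⨆ u : E, (((inner ℝ z u : ℝ) : EReal) - f u)

/-- `u` minimizes `v ↦ f v + ½ ‖v - z‖²`. -/
def IsProxPoint {E : Type*} [NormedAddCommGroup E] [InnerProductSpace ℝ E]
    (f : E → EReal) (z u : E) : Prop :=
  ∀ v : E, f u + ((1 / 2 * ‖u - z‖ ^ 2 : ℝ) : EReal) ≤ f v + ((1 / 2 * ‖v - z‖ ^ 2 : ℝ) : EReal)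

/-- The proximal mapping `prox_f(z) = argmin_u { f u + ½ ‖u - z‖² }`. For a proper closed convex
`f` the minimizer exists and is unique; where there is no minimizer the value is arbitrary. -/
def prox {E : Type*} [NormedAddCommGroup E] [InnerProductSpace ℝ E]
    (f : E → EReal) (z : E) : E :=
  Classical.epsilon (IsProxPoint f z)

/-- `x` is an optimal solution of "minimize `F` over `C`": it is feasible, its objective value is
not `+∞`, and no feasible point has a smaller objective value. -/
def IsOptimalSolution {E : Type*} (C : Set E) (F : E → EReal) (x : E) : Prop :=
  x ∈ C ∧ F x < ⊤ ∧ ∀ x' ∈ C, F x ≤ F x'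

section Problem

variable {Z Y : Type*}
  [NormedAddCommGroup Z] [InnerProductSpace ℝ Z] [CompleteSpace Z]
  [NormedAddCommGroup Y] [InnerProductSpace ℝ Y] [CompleteSpace Y]

/-- The primal objective `F z = h z + P (M z - b)`. -/
def primalObjective (h : Z → ℝ) (P : Y → EReal) (M : Z →L[ℝ] Y) (b : Y) (z : Z) : EReal :=
  (h z : EReal) + P (M z - b)

/-- The dual objective `h^*(x) + P^*(y) + ⟨b, y⟩`. -/
def dualObjective (h : Z → ℝ) (P : Y → EReal) (b : Y) (p : Z × Y) : EReal :=
  conj (fun z => (h z : EReal)) p.1 + conj P p.2 + ((inner ℝ b p.2 : ℝ) : EReal)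

/-- The feasible set `{(x, y) | x + M^* y = 0}` of the dual. -/
def dualFeasible (M : Z →L[ℝ] Y) : Set (Z × Y) :=
  {p | p.1 + ContinuousLinearMap.adjoint M p.2 = 0}

/-- The linear map `T = τ I - β M M^*` on `Y`. -/
def proxTerm (M : Z →L[ℝ] Y) (β τ : ℝ) : Y →L[ℝ] Y :=
  τ • ContinuousLinearMap.id ℝ Y - β • (M ∘L ContinuousLinearMap.adjoint M)

/-- The sequences `y`, `z` satisfy the recursion of the proximal-proximal gradient algorithm
(with arbitrary starting point `(y 0, z 0)`). -/
structure IsPPGSequence (h : Z → ℝ) (P : Y → EReal) (M : Z →L[ℝ] Y) (b : Y)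
    (β γ τ : ℝ) (y : ℕ → Y) (z : ℕ → Z) : Prop where
  y_update : ∀ t, y (t + 1) =
    prox (fun v => ((τ⁻¹ : ℝ) : EReal) * conj P v)
      (τ⁻¹ • (proxTerm M β τ (y t) - b + M (z t) - β • M (gradient h (z t))))
  z_update : ∀ t, z (t + 1) =
    z t - (γ * β) • (gradient h (z t) + ContinuousLinearMap.adjoint M (y (t + 1)))

end Problem

end PPG

end

/-! In a suitable (semi)metric the iterates never move away from any Karush–Kuhn–Tucker pair (z*,
y*), i.e. ∇h z* + M* y* = 0 and y* ∈ ∂P(M z* - b). Such a pair exists: an optimal z₀ also minimizes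
⟨∇h z₀, z⟩ + P(M z - b), and under the relative interior condition separation produces a multiplier
(`exists_isKKTPoint`). Conversely, z* then solves (P) and (∇h z*, y*) solves (D).

Put r = ∇h z^t + M* y^{t+1} and d = ∇h z^t - ∇h z*. The proximal step says M(z^t - βr) - b + T(y^t -
y^{t+1}) ∈ ∂P*(y^{t+1}). Monotonicity of ∂P* and cocoercivity of ∇h make ‖z - z*‖²/(2γβ) + ½⟨T(y -
y*), y - y*⟩ drop by at least β(1 - γ/2)‖r‖² + ‖d‖²/L - β‖r‖‖d‖ plus a nonnegative T-term
(`lyapunov_decrease`). The stepsize bounds make this form positive definite, so r, d → 0 and the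
iterates are bounded. The graph of ∂P* is closed, so a cluster point is again a KKT pair; the
Lyapunov function centred there is antitone and vanishes along a subsequence, hence tends to 0. -/

noncomputable section

namespace PPG

/-! ### Subgradients, conjugates and proximal points of extended-real-valued functions. -/

section Subgradient

variable {E : Type*} [NormedAddCommGroup E] [InnerProductSpace ℝ E]

/-- `s` is a subgradient of the extended-real-valued function `f` at `u`, where `f` is finite. -/
def HasSubgradientAt (f : E → EReal) (s u : E) : Prop :=
  ∃ r : ℝ, f u = r ∧ ∀ v, ((r + inner ℝ s (v - u) : ℝ) : EReal) ≤ f v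

theorem HasSubgradientAt.inner_sub_nonneg {f : E → EReal} {s u s' u' : E}
    (h : HasSubgradientAt f s u) (h' : HasSubgradientAt f s' u') :
    0 ≤ inner ℝ (s - s') (u - u') := by
  obtain ⟨r, hr, h⟩ := h
  obtain ⟨r', hr', h'⟩ := h'
  have h1 := h u'
  have h2 := h' u
  rw [hr', EReal.coe_le_coe_iff] at h1
  rw [hr, EReal.coe_le_coe_iff] at h2
  simp only [inner_sub_left, inner_sub_right] at *
  linarith

theorem HasSubgradientAt.conj_eq {f : E → EReal} {s u : E} {r : ℝ} (hr : f u = r)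
    (h : ∀ v, ((r + inner ℝ s (v - u) : ℝ) : EReal) ≤ f v) :
    conj f s = ((inner ℝ s u - r : ℝ) : EReal) := by
  apply le_antisymm
  · refine iSup_le fun v => ?_
    refine (EReal.sub_le_sub le_rfl (h v)).trans ?_
    rw [← EReal.coe_sub, EReal.coe_le_coe_iff, inner_sub_right]
    linarith
  · refine le_trans ?_ (le_iSup _ u)
    rw [hr, ← EReal.coe_sub]

theorem le_conj {f : E → EReal} {u : E} {r : ℝ} (hr : f u = r) (v : E) :
    ((inner ℝ v u - r : ℝ) : EReal) ≤ conj f v := by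
  refine le_trans ?_ (le_iSup _ u)
  rw [hr, ← EReal.coe_sub]

theorem HasSubgradientAt.conj {f : E → EReal} {s u : E} (h : HasSubgradientAt f s u) :
    HasSubgradientAt (PPG.conj f) u s := by
  obtain ⟨r, hr, h⟩ := h
  refine ⟨_, HasSubgradientAt.conj_eq hr h, fun v => ?_⟩
  refine le_trans ?_ (le_conj hr v)
  rw [EReal.coe_le_coe_iff, inner_sub_right, real_inner_comm v u, real_inner_comm s u]
  linarith

theorem ProperClosedConvex.eq_coe_or_eq_top {f : E → EReal} (hf : ProperClosedConvex f) (v : E) :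
    (∃ a : ℝ, f v = a) ∨ f v = ⊤ := by
  induction hv : f v with
  | bot => exact absurd hv (hf.ne_bot v)
  | coe a => exact Or.inl ⟨a, rfl⟩
  | top => exact Or.inr rfl

theorem ProperClosedConvex.exists_coe {f : E → EReal} (hf : ProperClosedConvex f) :
    ∃ v, ∃ a : ℝ, f v = a := by
  obtain ⟨v, hv⟩ := hf.dom_nonempty
  rcases hf.eq_coe_or_eq_top v with h | h
  · exact ⟨v, h⟩
  · simp [dom, h] at hv

/-- The subgradient inequality at a fixed `v` bounds `f (u n)` above by a convergent sequence, and
lower semicontinuity carries the bound to `u'`. One finite value of `f` then excludes `f u' = ⊤`. -/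
theorem ProperClosedConvex.hasSubgradientAt_of_tendsto {f : E → EReal}
    (hf : ProperClosedConvex f) {s u : ℕ → E} {s' u' : E}
    (hs : Tendsto s atTop (𝓝 s')) (hu : Tendsto u atTop (𝓝 u'))
    (h : ∀ n, HasSubgradientAt f (s n) (u n)) : HasSubgradientAt f s' u' := by
  have key : ∀ v, ∀ a : ℝ, f v = a → f u' ≤ ((a - inner ℝ s' (v - u') : ℝ) : EReal) := by
    intro v a ha
    refine EReal.le_of_forall_lt_iff_le.1 fun c hc => ?_
    rw [EReal.coe_lt_coe_iff] at hc
    by_contra hlt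
    rw [not_le] at hlt
    have h1 : ∀ᶠ n in atTop, (c : EReal) < f (u n) := hu.eventually (hf.closed u' c hlt)
    have h2 : Tendsto (fun n => a - inner ℝ (s n) (v - u n)) atTop
        (𝓝 (a - inner ℝ s' (v - u'))) :=
      tendsto_const_nhds.sub (hs.inner (tendsto_const_nhds.sub hu))
    obtain ⟨n, hn1, hn2⟩ := (h1.and (h2.eventually (gt_mem_nhds hc))).exists
    obtain ⟨r, hr, hle⟩ := h n
    have h3 := hle v
    rw [ha, EReal.coe_le_coe_iff] at h3
    rw [hr, EReal.coe_lt_coe_iff] at hn1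
    linarith
  obtain ⟨v₀, a₀, h₀⟩ := hf.exists_coe
  rcases hf.eq_coe_or_eq_top u' with ⟨r, hr⟩ | htop
  · refine ⟨r, hr, fun v => ?_⟩
    rcases hf.eq_coe_or_eq_top v with ⟨a, ha⟩ | hv
    · have := key v a ha
      rw [hr, EReal.coe_le_coe_iff] at this
      rw [ha, EReal.coe_le_coe_iff]
      linarith
    · rw [hv]; exact le_top
  · have := key v₀ a₀ h₀
    rw [htop, top_le_iff] at this
    exact absurd this (EReal.coe_ne_top _)

theorem ProperClosedConvex.conj {f : E → EReal} (hf : ProperClosedConvex f)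
    (hdom : (dom (PPG.conj f)).Nonempty) : ProperClosedConvex (PPG.conj f) where
  ne_bot z := by
    obtain ⟨v, a, ha⟩ := hf.exists_coe
    intro hz
    have := le_conj ha z
    rw [hz, le_bot_iff] at this
    exact EReal.coe_ne_bot _ this
  dom_nonempty := hdom
  closed := by
    refine lowerSemicontinuous_iSup fun u => ?_
    rcases hf.eq_coe_or_eq_top u with ⟨a, ha⟩ | hu
    · simp_rw [ha, ← EReal.coe_sub]
      exact (continuous_coe_real_ereal.comp (by fun_prop)).lowerSemicontinuous
    · simp_rw [hu, EReal.sub_top]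
      exact lowerSemicontinuous_const
  convex := by
    have : {p : E × ℝ | PPG.conj f p.1 ≤ (p.2 : EReal)} =
        ⋂ u : E, {p : E × ℝ | ((inner ℝ p.1 u : ℝ) : EReal) - f u ≤ (p.2 : EReal)} := by
      ext p; simp [PPG.conj, iSup_le_iff]
    rw [this]
    refine convex_iInter fun u => ?_
    rcases hf.eq_coe_or_eq_top u with ⟨a, ha⟩ | hu
    · simp_rw [ha, ← EReal.coe_sub, EReal.coe_le_coe_iff]
      intro p hp q hq s t hs ht hst
      simp only [Set.mem_ofPred_eq, Prod.fst_add, Prod.snd_add, Prod.smul_fst, Prod.smul_snd,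
        inner_add_left, inner_smul_left, smul_eq_mul, RCLike.conj_to_real] at *
      have h1 := mul_le_mul_of_nonneg_left hp hs
      have h2 := mul_le_mul_of_nonneg_left hq ht
      have h3 : s * a + t * a = a := by rw [← add_mul, hst, one_mul]
      linarith
    · simp_rw [hu, EReal.sub_top]
      simpa using convex_univ

theorem ProperClosedConvex.convex_comb_le {f : E → EReal} (hf : ProperClosedConvex f)
    {u v : E} {r a t : ℝ} (hu : f u ≤ r) (hv : f v ≤ a) (ht0 : 0 ≤ t) (ht1 : t ≤ 1) :
    f (u + t • (v - u)) ≤ ((r + t * (a - r) : ℝ) : EReal) := by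
  have := hf.convex (x := (u, r)) hu (y := (v, a)) hv (sub_nonneg.2 ht1) ht0 (by ring)
  simp only [Set.mem_ofPred_eq, Prod.fst_add, Prod.snd_add, Prod.smul_fst, Prod.smul_snd,
    smul_eq_mul] at this
  convert this using 2
  · module
  · ring

/-- Divide by `t` and let `t → 0`. This extracts first-order conditions from minimality along a
segment. -/
theorem nonneg_of_forall_mul_add_sq_mul_nonneg {A B : ℝ}
    (h : ∀ t : ℝ, 0 < t → t ≤ 1 → 0 ≤ t * A + t ^ 2 * B) : 0 ≤ A := by
  by_contra hA
  rw [not_le] at hA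
  have hB : 0 < |B| + 1 := by positivity
  set t := min 1 (-A / (2 * (|B| + 1))) with ht
  have ht0 : 0 < t := lt_min one_pos (div_pos (by linarith) (by positivity))
  have h1 := h t ht0 (min_le_left _ _)
  have h2 : t * (2 * (|B| + 1)) ≤ -A := by
    rw [← le_div_iff₀ (by positivity)]; exact min_le_right _ _
  have h3 : 0 ≤ A + t * B := by
    by_contra hc
    nlinarith
  nlinarith [le_abs_self B, mul_le_mul_of_nonneg_left (le_abs_self B) ht0.le]

theorem ProperClosedConvex.hasSubgradientAt_of_isProxPoint {f : E → EReal}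
    (hf : ProperClosedConvex f) {z u : E} (h : IsProxPoint f z u) :
    HasSubgradientAt f (z - u) u := by
  obtain ⟨v₀, a₀, h₀⟩ := hf.exists_coe
  have hu : ∃ r : ℝ, f u = r := by
    rcases hf.eq_coe_or_eq_top u with h' | h'
    · exact h'
    · have := h v₀
      rw [h', h₀, ← EReal.coe_add, EReal.top_add_coe, top_le_iff] at this
      exact absurd this (EReal.coe_ne_top _)
  obtain ⟨r, hr⟩ := hu
  refine ⟨r, hr, fun v => ?_⟩
  rcases hf.eq_coe_or_eq_top v with ⟨a, ha⟩ | hv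
  swap
  · rw [hv]; exact le_top
  rw [ha, EReal.coe_le_coe_iff]
  suffices 0 ≤ a - r + inner ℝ (u - z) (v - u) by
    rw [← neg_sub u z, inner_neg_left]; linarith
  refine nonneg_of_forall_mul_add_sq_mul_nonneg (B := 1 / 2 * ‖v - u‖ ^ 2) fun t ht0 ht1 => ?_
  have h1 := h (u + t • (v - u))
  have h2 := h1.trans (add_le_add (hf.convex_comb_le hr.le ha.le ht0.le ht1) le_rfl)
  rw [hr, ← EReal.coe_add, ← EReal.coe_add, EReal.coe_le_coe_iff] at h2
  have h3 : ‖u + t • (v - u) - z‖ ^ 2 =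
      ‖u - z‖ ^ 2 + 2 * (t * inner ℝ (u - z) (v - u)) + t ^ 2 * ‖v - u‖ ^ 2 := by
    rw [show u + t • (v - u) - z = (u - z) + t • (v - u) by abel, norm_add_sq_real,
      inner_smul_right, norm_smul, mul_pow, Real.norm_eq_abs, sq_abs]
  rw [h3] at h2
  linarith

theorem ProperClosedConvex.exists_isProxPoint [FiniteDimensional ℝ E] {f : E → EReal}
    (hf : ProperClosedConvex f) {s : E} {c : ℝ}
    (hmin : ∀ v, ((inner ℝ s v + c : ℝ) : EReal) ≤ f v) (z : E) : ∃ u, IsProxPoint f z u := by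
  obtain ⟨v₀, a₀, h₀⟩ := hf.exists_coe
  set G : E → EReal := fun v => f v + ((1 / 2 * ‖v - z‖ ^ 2 : ℝ) : EReal) with hG
  have hGlsc : LowerSemicontinuous G := by
    refine LowerSemicontinuous.add' hf.closed
      (continuous_coe_real_ereal.comp (by fun_prop)).lowerSemicontinuous fun v => ?_
    exact EReal.continuousAt_add (Or.inr (EReal.coe_ne_bot _)) (Or.inr (EReal.coe_ne_top _))
  set a := a₀ + 1 / 2 * ‖v₀ - z‖ ^ 2 with ha
  have hGv₀ : G v₀ = (a : ℝ) := by simp only [hG, h₀, ← EReal.coe_add, ha]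
  set K : ℝ := a - c - inner ℝ s z with hK
  -- Completing the square in ½‖v - z‖² + ⟨s, v - z⟩ ≤ K gives (‖v - z‖ - ‖s‖)² ≤ 2|K| + ‖s‖², so
  -- the sublevel set lies in a compact ball.
  set R : ℝ := ‖s‖ + Real.sqrt (2 * |K| + ‖s‖ ^ 2) with hR
  have hbound : ∀ v, G v ≤ a → v ∈ Metric.closedBall z R := by
    intro v hv
    have h1 : ((inner ℝ s v + c + 1 / 2 * ‖v - z‖ ^ 2 : ℝ) : EReal) ≤ a := by
      refine le_trans ?_ hv
      rw [EReal.coe_add]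
      exact add_le_add (hmin v) le_rfl
    rw [EReal.coe_le_coe_iff] at h1
    have h2 : inner ℝ s v = inner ℝ s z + inner ℝ s (v - z) := by
      rw [inner_sub_right]; ring
    have h3 := neg_le_of_abs_le (abs_real_inner_le_norm s (v - z))
    have h4 : (‖v - z‖ - ‖s‖) ^ 2 ≤ 2 * |K| + ‖s‖ ^ 2 := by
      nlinarith [le_abs_self K]
    have h5 := Real.le_sqrt_of_sq_le h4
    rw [mem_closedBall_iff_norm]
    linarith
  obtain ⟨u, hu, humin⟩ := LowerSemicontinuousOn.exists_isMinOn
    ⟨v₀, hbound v₀ hGv₀.le⟩ (isCompact_closedBall z R)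
    (hGlsc.lowerSemicontinuousOn _)
  refine ⟨u, fun v => ?_⟩
  by_cases hv : G v ≤ a
  · exact humin (hbound v hv)
  · exact (humin (hbound v₀ hGv₀.le)).trans (hGv₀.le.trans (not_le.1 hv).le)

theorem HasSubgradientAt.exists_affine_le {f : E → EReal} {s u : E}
    (h : HasSubgradientAt f s u) : ∃ c : ℝ, ∀ v, ((inner ℝ s v + c : ℝ) : EReal) ≤ f v := by
  obtain ⟨r, -, h⟩ := h
  refine ⟨r - inner ℝ s u, fun v => le_trans (le_of_eq ?_) (h v)⟩
  rw [inner_sub_right]; congr 1; ring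

/-- The subdifferential of the conjugate is the inverse of the subdifferential. -/
theorem ProperClosedConvex.hasSubgradientAt_of_conj [FiniteDimensional ℝ E] {f : E → EReal}
    (hf : ProperClosedConvex f) {s y : E} (h : HasSubgradientAt (PPG.conj f) s y) :
    HasSubgradientAt f y s := by
  obtain ⟨r, hr, -⟩ := id h
  have hmin : ∀ v, ((inner ℝ y v + -r : ℝ) : EReal) ≤ f v := by
    intro v
    rcases hf.eq_coe_or_eq_top v with ⟨a, ha⟩ | hv
    · have := le_conj ha y
      rw [hr, EReal.coe_le_coe_iff] at this
      rw [ha, EReal.coe_le_coe_iff]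
      linarith
    · rw [hv]; exact le_top
  -- The proximal point satisfies s + y - p ∈ ∂f(p), hence p ∈ ∂f*(s + y - p). Monotonicity against
  -- s ∈ ∂f*(y) gives -‖s - p‖² ≥ 0, so p = s, without using f** = f.
  obtain ⟨p, hp⟩ := hf.exists_isProxPoint hmin (s + y)
  have hp' := hf.hasSubgradientAt_of_isProxPoint hp
  have hmono := h.inner_sub_nonneg hp'.conj
  have hps : s - p = 0 := by
    rw [show y - (s + y - p) = -(s - p) by abel, inner_neg_right, real_inner_self_eq_norm_sq]
      at hmono
    rw [← norm_eq_zero, ← sq_eq_zero_iff]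
    exact le_antisymm (by linarith) (sq_nonneg _)
  rw [sub_eq_zero] at hps
  subst hps
  simpa using hp'

theorem coe_mul_le_coe_iff {c : ℝ} (hc : 0 < c) (x : EReal) (r : ℝ) :
    (c : EReal) * x ≤ r ↔ x ≤ ((c⁻¹ * r : ℝ) : EReal) := by
  induction x with
  | bot => simp [EReal.coe_mul_bot_of_pos hc, -EReal.coe_mul]
  | coe a =>
    rw [← EReal.coe_mul, EReal.coe_le_coe_iff, EReal.coe_le_coe_iff, inv_mul_eq_div,
      le_div_iff₀ hc, mul_comm]
  | top => simp [EReal.coe_mul_top_of_pos hc, -EReal.coe_mul]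

theorem coe_mul_eq_coe_iff {c : ℝ} (hc : 0 < c) (x : EReal) (r : ℝ) :
    (c : EReal) * x = r ↔ x = ((c⁻¹ * r : ℝ) : EReal) := by
  induction x with
  | bot => simp [EReal.coe_mul_bot_of_pos hc, -EReal.coe_mul]
  | coe a =>
    rw [← EReal.coe_mul, EReal.coe_eq_coe_iff, EReal.coe_eq_coe_iff, inv_mul_eq_div,
      eq_div_iff hc.ne', mul_comm]
  | top => simp [EReal.coe_mul_top_of_pos hc, -EReal.coe_mul]

theorem coe_le_coe_mul_iff {c : ℝ} (hc : 0 < c) (x : EReal) (r : ℝ) :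
    (r : EReal) ≤ c * x ↔ ((c⁻¹ * r : ℝ) : EReal) ≤ x := by
  induction x with
  | bot => simp [EReal.coe_mul_bot_of_pos hc, -EReal.coe_mul]
  | coe a =>
    rw [← EReal.coe_mul, EReal.coe_le_coe_iff, EReal.coe_le_coe_iff, inv_mul_eq_div,
      div_le_iff₀ hc, mul_comm]
  | top => simp [EReal.coe_mul_top_of_pos hc, -EReal.coe_mul]

theorem ProperClosedConvex.const_mul {f : E → EReal} (hf : ProperClosedConvex f) {c : ℝ}
    (hc : 0 < c) : ProperClosedConvex fun v => (c : EReal) * f v where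
  ne_bot v := by
    rcases hf.eq_coe_or_eq_top v with ⟨a, ha⟩ | hv
    · simp only [ha, ← EReal.coe_mul]; exact EReal.coe_ne_bot _
    · simp [hv, EReal.coe_mul_top_of_pos hc]
  dom_nonempty := by
    obtain ⟨v, a, ha⟩ := hf.exists_coe
    refine ⟨v, ?_⟩
    simp only [dom, Set.mem_ofPred_eq, ha, ← EReal.coe_mul]
    exact EReal.coe_lt_top _
  closed := by
    have hcont : Continuous fun x : EReal => (c : EReal) * x := by
      rw [continuous_iff_continuousAt]
      intro x
      exact (EReal.continuousAt_mul (p := ((c : EReal), x)) (Or.inl (by simpa using hc.ne'))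
        (Or.inl (by simpa using hc.ne')) (Or.inl (EReal.coe_ne_bot _))
        (Or.inl (EReal.coe_ne_top _))).comp (by fun_prop)
    exact hcont.comp_lowerSemicontinuous hf.closed fun x y hxy =>
      mul_le_mul_of_nonneg_left hxy (by exact_mod_cast hc.le)
  convex := by
    simp_rw [coe_mul_le_coe_iff hc]
    intro p hp q hq s t hs ht hst
    have := hf.convex (x := (p.1, c⁻¹ * p.2)) hp (y := (q.1, c⁻¹ * q.2)) hq hs ht hst
    simp only [Set.mem_ofPred_eq, Prod.fst_add, Prod.snd_add, Prod.smul_fst, Prod.smul_snd,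
      smul_eq_mul] at *
    convert this using 2
    ring

theorem HasSubgradientAt.of_const_mul {f : E → EReal} {c : ℝ} (hc : 0 < c) {s u : E}
    (h : HasSubgradientAt (fun v => (c : EReal) * f v) s u) :
    HasSubgradientAt f (c⁻¹ • s) u := by
  obtain ⟨r, hr, h⟩ := h
  refine ⟨c⁻¹ * r, (coe_mul_eq_coe_iff hc _ _).1 hr, fun v => ?_⟩
  have := (coe_le_coe_mul_iff hc _ _).1 (h v)
  rwa [mul_add, ← real_inner_smul_left] at this

/-- The optimality condition of the proximal step with parameter `τ`. -/
theorem ProperClosedConvex.hasSubgradientAt_prox [FiniteDimensional ℝ E] {f : E → EReal}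
    (hf : ProperClosedConvex f) {s₀ u₀ : E} (h₀ : HasSubgradientAt f s₀ u₀) {τ : ℝ} (hτ : 0 < τ)
    (z : E) :
    HasSubgradientAt f (τ • (z - prox (fun v => ((τ⁻¹ : ℝ) : EReal) * f v) z))
      (prox (fun v => ((τ⁻¹ : ℝ) : EReal) * f v) z) := by
  have hτ' : 0 < τ⁻¹ := inv_pos.2 hτ
  have hg := hf.const_mul hτ'
  obtain ⟨c, hc⟩ := h₀.exists_affine_le
  have hmin : ∀ v, ((inner ℝ (τ⁻¹ • s₀) v + τ⁻¹ * c : ℝ) : EReal) ≤ ((τ⁻¹ : ℝ) : EReal) * f v := by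
    intro v
    rw [coe_le_coe_mul_iff hτ', real_inner_smul_left, ← mul_add, inv_inv,
      mul_inv_cancel_left₀ hτ.ne']
    exact hc v
  -- `prox` is an `epsilon` choice, so its minimality is available only once some minimizer exists.
  have hex := hg.exists_isProxPoint hmin z
  have h1 := hg.hasSubgradientAt_of_isProxPoint (Classical.epsilon_spec hex)
  have h2 := h1.of_const_mul hτ'
  rwa [inv_inv] at h2

end Subgradient

/-! ### Convex functions with Lipschitz gradient. -/

section Smooth

variable {E : Type*} [NormedAddCommGroup E] [InnerProductSpace ℝ E] [CompleteSpace E]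

theorem hasDerivAt_comp_line {h : E → ℝ} (h_diff : Differentiable ℝ h) (u e : E) (t : ℝ) :
    HasDerivAt (fun s : ℝ => h (u + s • e)) (inner ℝ (gradient h (u + t • e)) e) t := by
  have h1 : HasDerivAt (fun s : ℝ => u + s • e) e t := by
    simpa using ((hasDerivAt_id t).smul_const e).const_add u
  have h2 := (h_diff (u + t • e)).hasGradientAt.hasFDerivAt.comp_hasDerivAt t h1
  simpa [Function.comp_def] using h2

theorem add_inner_gradient_le {h : E → ℝ} (h_convex : ConvexOn ℝ Set.univ h)
    (h_diff : Differentiable ℝ h) (u v : E) : h u + inner ℝ (gradient h u) (v - u) ≤ h v := by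
  have hc : ConvexOn ℝ Set.univ (fun s : ℝ => h (u + s • (v - u))) := by
    have := h_convex.comp_affineMap (AffineMap.lineMap u v : ℝ →ᵃ[ℝ] E)
    simpa [Function.comp_def, AffineMap.lineMap_apply, add_comm] using this
  have hd := hasDerivAt_comp_line h_diff u (v - u) 0
  rw [zero_smul, add_zero] at hd
  have := hc.le_slope_of_hasDerivAt (Set.mem_univ 0) (Set.mem_univ 1) one_pos hd
  rw [slope_def_field, sub_zero, div_one, zero_smul, one_smul, add_zero,
    add_sub_cancel] at this
  linarith

/-- The descent lemma for functions with Lipschitz gradient. -/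
theorem le_add_inner_gradient_add_sq {h : E → ℝ} {L : ℝ} (h_diff : Differentiable ℝ h)
    (h_lip : ∀ z₁ z₂ : E, ‖gradient h z₁ - gradient h z₂‖ ≤ L * ‖z₁ - z₂‖) (u v : E) :
    h v ≤ h u + inner ℝ (gradient h u) (v - u) + L / 2 * ‖v - u‖ ^ 2 := by
  set e := v - u with he
  set q : ℝ → ℝ := fun s =>
    h (u + s • e) - (s * inner ℝ (gradient h u) e + s ^ 2 * (L / 2 * ‖e‖ ^ 2)) with hq
  have hd : ∀ t, HasDerivAt q (inner ℝ (gradient h (u + t • e)) e -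
      (inner ℝ (gradient h u) e + 2 * t * (L / 2 * ‖e‖ ^ 2))) t := by
    intro t
    have h1 := (hasDerivAt_id t).mul_const (inner ℝ (gradient h u) e)
    have h2 := ((hasDerivAt_id t).pow 2).mul_const (L / 2 * ‖e‖ ^ 2)
    have h3 := (hasDerivAt_comp_line h_diff u e t).sub (h1.add h2)
    refine h3.congr_deriv ?_
    simp
  have hanti : AntitoneOn q (Set.Icc 0 1) := by
    refine antitoneOn_of_deriv_nonpos (convex_Icc 0 1)
      (fun t _ => (hd t).continuousAt.continuousWithinAt)
      (fun t _ => (hd t).differentiableAt.differentiableWithinAt) fun t ht => ?_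
    rw [interior_Icc] at ht
    rw [(hd t).deriv]
    have h1 := h_lip (u + t • e) u
    rw [add_sub_cancel_left, norm_smul, Real.norm_of_nonneg ht.1.le] at h1
    have h2 := real_inner_le_norm (gradient h (u + t • e) - gradient h u) e
    rw [inner_sub_left] at h2
    nlinarith [mul_le_mul_of_nonneg_right h1 (norm_nonneg e)]
  have := hanti (Set.left_mem_Icc.2 zero_le_one) (Set.right_mem_Icc.2 zero_le_one) zero_le_one
  simp only [hq, one_smul, zero_smul, add_zero] at this
  rw [show u + e = v by rw [he]; abel] at this
  linarith

/-- With d = ∇h v - ∇h u, compare at v - d/L the tangent of h at u (a lower bound) with the descent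
parabola at v (an upper bound). The step 1/L maximizes the gain. -/
theorem add_inner_gradient_add_sq_le {h : E → ℝ} {L : ℝ} (hL : 0 < L)
    (h_convex : ConvexOn ℝ Set.univ h) (h_diff : Differentiable ℝ h)
    (h_lip : ∀ z₁ z₂ : E, ‖gradient h z₁ - gradient h z₂‖ ≤ L * ‖z₁ - z₂‖) (u v : E) :
    h u + inner ℝ (gradient h u) (v - u) + 1 / (2 * L) * ‖gradient h v - gradient h u‖ ^ 2
      ≤ h v := by
  set d := gradient h v - gradient h u with hd
  have h1 := add_inner_gradient_le h_convex h_diff u (v - L⁻¹ • d)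
  have h2 := le_add_inner_gradient_add_sq h_diff h_lip v (v - L⁻¹ • d)
  have h3 : inner ℝ (gradient h v) d - inner ℝ (gradient h u) d = ‖d‖ ^ 2 := by
    rw [← inner_sub_left, ← hd, real_inner_self_eq_norm_sq]
  rw [show v - L⁻¹ • d - u = (v - u) - L⁻¹ • d by abel, inner_sub_right,
    inner_smul_right] at h1
  rw [sub_sub_cancel_left, inner_neg_right, inner_smul_right, norm_neg, norm_smul, mul_pow,
    Real.norm_eq_abs, sq_abs] at h2
  have h4 : L / 2 * (L⁻¹ ^ 2 * ‖d‖ ^ 2) = 1 / 2 * (L⁻¹ * ‖d‖ ^ 2) := by field_simp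
  have h5 : 1 / (2 * L) * ‖d‖ ^ 2 = 1 / 2 * (L⁻¹ * ‖d‖ ^ 2) := by field_simp
  have h6 : L⁻¹ * inner ℝ (gradient h v) d - L⁻¹ * inner ℝ (gradient h u) d
      = L⁻¹ * ‖d‖ ^ 2 := by rw [← h3]; ring
  linarith

/-- The Baillon–Haddad theorem: an `L`-Lipschitz gradient of a convex function is
`1 / L`-cocoercive. -/
theorem norm_gradient_sub_sq_le {h : E → ℝ} {L : ℝ} (hL : 0 < L)
    (h_convex : ConvexOn ℝ Set.univ h) (h_diff : Differentiable ℝ h)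
    (h_lip : ∀ z₁ z₂ : E, ‖gradient h z₁ - gradient h z₂‖ ≤ L * ‖z₁ - z₂‖) (u v : E) :
    ‖gradient h u - gradient h v‖ ^ 2 ≤ L * inner ℝ (gradient h u - gradient h v) (u - v) := by
  have h1 := add_inner_gradient_add_sq_le hL h_convex h_diff h_lip u v
  have h2 := add_inner_gradient_add_sq_le hL h_convex h_diff h_lip v u
  rw [norm_sub_rev] at h1
  rw [← neg_sub u v, inner_neg_right] at h1
  have h3 : 1 / (2 * L) * ‖gradient h u - gradient h v‖ ^ 2 * (2 * L) =
      ‖gradient h u - gradient h v‖ ^ 2 := by field_simp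
  rw [inner_sub_left]
  nlinarith

end Smooth

/-! ### Separation by a linear functional, and relative interiors. -/

section Separation

/-- A convex set `D` in `V × ℝ`, upward closed, lying above `0` at the origin and whose projection
to `V` is a neighbourhood of the origin in its span, lies above the graph of a linear functional. -/
theorem exists_linearMap_le {V : Type*} [AddCommGroup V] [Module ℝ V] {D : Set (V × ℝ)}
    (hD : Convex ℝ D) (h0 : (0, 0) ∈ D)
    (hup : ∀ w s s', (w, s) ∈ D → s ≤ s' → (w, s') ∈ D)
    (hnonneg : ∀ s : ℝ, ((0 : V), s) ∈ D → 0 ≤ s)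
    (hsymm : ∀ w s, (w, s) ∈ D → ∃ ε : ℝ, 0 < ε ∧ ∃ s', (-(ε • w), s') ∈ D) :
    ∃ f : V →ₗ[ℝ] ℝ, ∀ w s, (w, s) ∈ D → f w ≤ s := by
  set C : ConvexCone ℝ (V × ℝ) := ConvexCone.hull ℝ D with hC
  have hDC : ∀ p ∈ D, p ∈ C := fun p hp => ConvexCone.subset_hull hp
  have hmem : ∀ p, p ∈ C ↔ ∃ c : ℝ, 0 < c ∧ c • p ∈ D := by
    intro p
    rw [hC, ConvexCone.mem_hull_of_convex hD]
    constructor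
    · rintro ⟨c, hc, hp⟩
      exact ⟨c⁻¹, inv_pos.2 hc, (Set.mem_smul_set_iff_inv_smul_mem₀ hc.ne' _ _).1 hp⟩
    · rintro ⟨c, hc, hp⟩
      refine ⟨c⁻¹, inv_pos.2 hc, ?_⟩
      rwa [Set.mem_smul_set_iff_inv_smul_mem₀ (inv_pos.2 hc).ne', inv_inv]
  have hup' : ∀ w s s', (w, s) ∈ C → s ≤ s' → (w, s') ∈ C := by
    intro w s s' hs hss
    obtain ⟨c, hc, hs⟩ := (hmem _).1 hs
    exact (hmem _).2 ⟨c, hc, hup _ (c • s) _ hs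
      (mul_le_mul_of_nonneg_left hss hc.le)⟩
  have hnonneg' : ∀ s : ℝ, ((0 : V), s) ∈ C → 0 ≤ s := by
    intro s hs
    obtain ⟨c, hc, hs⟩ := (hmem _).1 hs
    have := hnonneg (c * s) (by simpa using hs)
    exact nonneg_of_mul_nonneg_right this hc
  -- By `hsymm` the projection of `C` to `V` is closed under negative scalars. Working over this
  -- subspace secures the cofinality hypothesis of `riesz_extension`.
  let W : Submodule ℝ V :=
    { carrier := {w | ∃ s, (w, s) ∈ C}
      add_mem' := by
        rintro a b ⟨s, hs⟩ ⟨t, ht⟩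
        exact ⟨s + t, C.add_mem hs ht⟩
      zero_mem' := ⟨0, hDC _ h0⟩
      smul_mem' := by
        rintro c w ⟨s, hs⟩
        rcases lt_trichotomy c 0 with hc | hc | hc
        · obtain ⟨a, ha, hs⟩ := (hmem _).1 hs
          obtain ⟨ε, hε, s', hs'⟩ := hsymm _ _ hs
          refine ⟨(-c / (ε * a)) * s', ?_⟩
          have := C.smul_mem (c := -c / (ε * a)) (div_pos (by linarith) (by positivity))
            (hDC _ hs')
          convert this using 1
          ext
          · simp only [Prod.smul_mk, smul_smul, ← neg_smul]
            congr 1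
            field_simp
          · simp
        · subst hc
          exact ⟨0, by simpa using hDC _ h0⟩
        · exact ⟨c * s, C.smul_mem hc hs⟩ }
  let ι : W × ℝ →ₗ[ℝ] V × ℝ := W.subtype.prodMap LinearMap.id
  let K : PointedCone ℝ (W × ℝ) := (C.comap ι).toPointedCone (by
    change ι 0 ∈ C
    rw [map_zero]; exact hDC _ h0)
  have hK : ∀ (w : W) (s : ℝ), (w, s) ∈ K ↔ ((w : V), s) ∈ C := fun w s => Iff.rfl
  have hne : ((0 : W), (1 : ℝ)) ≠ 0 := by simp
  let f : (W × ℝ) →ₗ.[ℝ] ℝ := LinearPMap.mkSpanSingleton ((0 : W), (1 : ℝ)) (1 : ℝ) hne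
  have hf : ∀ x : f.domain, f x = (x : W × ℝ).2 ∧ (x : W × ℝ).1 = 0 := by
    rintro ⟨x, hx⟩
    obtain ⟨c, rfl⟩ := Submodule.mem_span_singleton.1 hx
    refine ⟨?_, by simp⟩
    refine (LinearPMap.mkSpanSingleton'_apply ((0 : W), (1 : ℝ)) (1 : ℝ) _ c hx).trans ?_
    simp
  obtain ⟨g, hg1, hg2⟩ := riesz_extension K f (by
    rintro x hx
    obtain ⟨h1, h2⟩ := hf x
    rw [h1]
    obtain ⟨⟨w, s⟩, hxd⟩ := x
    simp only at h2 hx ⊢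
    subst h2
    exact hnonneg' s ((hK _ _).1 hx)) (by
    rintro ⟨⟨w, t, ht⟩, s⟩
    refine ⟨⟨(t - s) • ((0 : W), (1 : ℝ)), Submodule.smul_mem _ _
      (Submodule.mem_span_singleton_self _)⟩, ?_⟩
    have : (t - s) • ((0 : W), (1 : ℝ)) + ((⟨w, t, ht⟩ : W), s) = (⟨w, t, ht⟩, t) := by
      ext <;> simp
    simp only [this]
    exact ht)
  have hg01 : ∀ s : ℝ, g (0, s) = s := by
    intro s
    have h1 := hg1 ⟨(s • ((0 : W), (1 : ℝ))), Submodule.smul_mem _ _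
      (Submodule.mem_span_singleton_self _)⟩
    rw [(hf _).1] at h1
    simpa using h1
  -- On the cone 0 ≤ g (w, s) = g (w, 0) + s, so -g (·, 0) is the required minorant on `W`.
  obtain ⟨F, hF⟩ := LinearMap.exists_extend (-(g ∘ₗ LinearMap.inl ℝ W ℝ))
  refine ⟨F, fun w s hws => ?_⟩
  have hw : w ∈ W := ⟨s, hDC _ hws⟩
  have h1 : F w = -g (⟨w, hw⟩, 0) := by
    have := congrArg (fun φ => φ ⟨w, hw⟩) hF
    simpa using this
  have h2 := hg2 (⟨w, hw⟩, s) ((hK _ _).2 (hDC _ hws))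
  have h3 : g (⟨w, hw⟩, s) = g (⟨w, hw⟩, 0) + s := by
    rw [← hg01 s, ← map_add]; simp [hg01]
  linarith

/-- The line from `u` through `u₀` stays in the affine span, in which `u₀` is interior, so it can be
prolonged a little beyond `u₀`. The constraint qualification enters in this form. -/
theorem exists_add_smul_mem_of_mem_intrinsicInterior {Y : Type*} [NormedAddCommGroup Y]
    [NormedSpace ℝ Y] {S : Set Y} {u₀ : Y} (h₀ : u₀ ∈ intrinsicInterior ℝ S)
    {u : Y} (hu : u ∈ S) : ∃ ε : ℝ, 0 < ε ∧ u₀ - ε • (u - u₀) ∈ S := by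
  obtain ⟨p, hp, rfl⟩ := mem_intrinsicInterior.1 h₀
  have hu' := subset_affineSpan ℝ S hu
  let φ : ℝ → affineSpan ℝ S := fun t =>
    ⟨AffineMap.lineMap (p : Y) u (-t), AffineMap.lineMap_mem _ p.2 hu'⟩
  have hφ : Continuous φ := by
    refine Continuous.subtype_mk ?_ _
    simp only [AffineMap.lineMap_apply]
    fun_prop
  have hφ0 : φ 0 = p := by ext; simp [φ]
  have h1 : ∀ᶠ t in 𝓝 (0 : ℝ), φ t ∈ interior ((↑) ⁻¹' S : Set (affineSpan ℝ S)) := by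
    refine hφ.continuousAt.eventually_mem ?_
    rw [hφ0]
    exact isOpen_interior.mem_nhds hp
  have h2 : ∀ᶠ t in 𝓝[>] (0 : ℝ), φ t ∈ interior ((↑) ⁻¹' S : Set (affineSpan ℝ S)) :=
    h1.filter_mono nhdsWithin_le_nhds
  obtain ⟨ε, hε, hpos⟩ := (h2.and self_mem_nhdsWithin).exists
  refine ⟨ε, hpos, ?_⟩
  have := interior_subset hε
  have h3 : ((φ ε : affineSpan ℝ S) : Y) ∈ S := this
  convert h3 using 1
  simp only [φ, AffineMap.lineMap_apply, vsub_eq_sub, vadd_eq_add]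
  module

end Separation

/-! ### Optimality conditions and multipliers. -/

theorem le_add_inner_gradient_of_isOptimalSolution {Z Y : Type*}
    [NormedAddCommGroup Z] [InnerProductSpace ℝ Z] [CompleteSpace Z]
    [NormedAddCommGroup Y] [InnerProductSpace ℝ Y]
    {h : Z → ℝ} {P : Y → EReal} {M : Z →L[ℝ] Y} {b : Y} {L : ℝ} (h_diff : Differentiable ℝ h)
    (h_lip : ∀ z₁ z₂ : Z, ‖gradient h z₁ - gradient h z₂‖ ≤ L * ‖z₁ - z₂‖)
    (hP : ProperClosedConvex P) {z₀ : Z}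
    (hz₀ : IsOptimalSolution Set.univ (primalObjective h P M b) z₀) {r : ℝ}
    (hr : P (M z₀ - b) = r) {z : Z} {a : ℝ} (ha : P (M z - b) ≤ a) :
    r ≤ a + inner ℝ (gradient h z₀) (z - z₀) := by
  suffices 0 ≤ a - r + inner ℝ (gradient h z₀) (z - z₀) by linarith
  -- Along the segment from `z₀` to `z`, h grows by at most t⟨∇h z₀, z - z₀⟩ + O(t²) and P by at
  -- most t(a - r).
  refine nonneg_of_forall_mul_add_sq_mul_nonneg (B := L / 2 * ‖z - z₀‖ ^ 2) fun t ht0 ht1 => ?_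
  have h1 := hz₀.2.2 (z₀ + t • (z - z₀)) (Set.mem_univ _)
  have h2 := hP.convex_comb_le hr.le ha ht0.le ht1
  have h3 : M (z₀ + t • (z - z₀)) - b = M z₀ - b + t • (M z - b - (M z₀ - b)) := by
    rw [map_add, map_smul, map_sub, sub_sub_sub_cancel_right]; abel
  rw [primalObjective, hr, primalObjective, h3] at h1
  have h4 := h1.trans (add_le_add le_rfl h2)
  rw [← EReal.coe_add, ← EReal.coe_add, EReal.coe_le_coe_iff] at h4
  have h5 := le_add_inner_gradient_add_sq h_diff h_lip z₀ (z₀ + t • (z - z₀))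
  rw [add_sub_cancel_left, inner_smul_right, norm_smul, mul_pow, Real.norm_eq_abs, sq_abs] at h5
  linarith

section Optimality

variable {Z Y : Type*}
  [NormedAddCommGroup Z] [InnerProductSpace ℝ Z] [CompleteSpace Z]
  [NormedAddCommGroup Y] [InnerProductSpace ℝ Y] [CompleteSpace Y]

/-- The Karush–Kuhn–Tucker conditions for the pair of a primal point `z` and a multiplier `y`. -/
structure IsKKTPoint (h : Z → ℝ) (P : Y → EReal) (M : Z →L[ℝ] Y) (b : Y) (z : Z) (y : Y) :
    Prop where
  gradient_add : gradient h z + ContinuousLinearMap.adjoint M y = 0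
  subgradient : HasSubgradientAt P y (M z - b)

variable {h : Z → ℝ} {P : Y → EReal} {M : Z →L[ℝ] Y} {b : Y}

theorem IsKKTPoint.isOptimalSolution_primal {z : Z} {y : Y} (hk : IsKKTPoint h P M b z y)
    (h_convex : ConvexOn ℝ Set.univ h) (h_diff : Differentiable ℝ h) :
    IsOptimalSolution Set.univ (primalObjective h P M b) z := by
  obtain ⟨r, hr, hle⟩ := hk.subgradient
  refine ⟨Set.mem_univ _, ?_, fun z' _ => ?_⟩
  · rw [primalObjective, hr, ← EReal.coe_add]
    exact EReal.coe_lt_top _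
  · rw [primalObjective, hr, ← EReal.coe_add, primalObjective]
    refine le_trans ?_ (add_le_add le_rfl (hle (M z' - b)))
    rw [← EReal.coe_add, EReal.coe_le_coe_iff]
    have h1 := add_inner_gradient_le h_convex h_diff z z'
    have h2 : inner ℝ (gradient h z) (z' - z) + inner ℝ y (M z' - b - (M z - b)) = 0 := by
      rw [sub_sub_sub_cancel_right, ← map_sub, ← ContinuousLinearMap.adjoint_inner_left,
        ← inner_add_left, hk.gradient_add, inner_zero_left]
    linarith

theorem hasSubgradientAt_coe_gradient (h_convex : ConvexOn ℝ Set.univ h)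
    (h_diff : Differentiable ℝ h) (z : Z) :
    HasSubgradientAt (fun z => (h z : EReal)) (gradient h z) z :=
  ⟨h z, rfl, fun v => EReal.coe_le_coe_iff.2 (add_inner_gradient_le h_convex h_diff z v)⟩

theorem IsKKTPoint.isOptimalSolution_dual {z : Z} {y : Y} (hk : IsKKTPoint h P M b z y)
    (h_convex : ConvexOn ℝ Set.univ h) (h_diff : Differentiable ℝ h) :
    IsOptimalSolution (dualFeasible M) (dualObjective h P b) (gradient h z, y) := by
  obtain ⟨r, hr, hle⟩ := hk.subgradient
  obtain ⟨r', hr', hle'⟩ := hasSubgradientAt_coe_gradient h_convex h_diff z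
  have hval : dualObjective h P b (gradient h z, y) =
      ((inner ℝ (gradient h z) z - r' + (inner ℝ y (M z - b) - r) + inner ℝ b y : ℝ) : EReal) := by
    rw [dualObjective, HasSubgradientAt.conj_eq hr hle, 
      HasSubgradientAt.conj_eq (f := fun z => (h z : EReal)) hr' hle',
      ← EReal.coe_add, ← EReal.coe_add]
  refine ⟨hk.gradient_add, ?_, ?_⟩
  · rw [hval]; exact EReal.coe_lt_top _
  · rintro ⟨x', y'⟩ hxy
    -- The Fenchel–Young lower bound based at `z` and `M z - b` is constant on the feasible set, and
    -- the candidate attains it.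
    have key : ∀ (x : Z) (y : Y), x + ContinuousLinearMap.adjoint M y = 0 →
        inner ℝ x z - r' + (inner ℝ y (M z - b) - r) + inner ℝ b y = -r' - r := by
      intro x y hxy
      have : inner ℝ (x + ContinuousLinearMap.adjoint M y) z = (0 : ℝ) := by
        rw [hxy, inner_zero_left]
      rw [inner_add_left, ContinuousLinearMap.adjoint_inner_left] at this
      rw [inner_sub_right, real_inner_comm y b]
      linarith
    rw [hval, key _ _ hk.gradient_add, ← key x' y' hxy, dualObjective, EReal.coe_add,
      EReal.coe_add]
    exact add_le_add (add_le_add (le_conj (f := fun z => (h z : EReal)) hr' x')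
      (le_conj hr y')) le_rfl

/-- Under the relative interior constraint qualification, every primal solution has a
multiplier. -/
theorem exists_isKKTPoint [FiniteDimensional ℝ Y] {L : ℝ} (h_diff : Differentiable ℝ h)
    (h_lip : ∀ z₁ z₂ : Z, ‖gradient h z₁ - gradient h z₂‖ ≤ L * ‖z₁ - z₂‖)
    (hP : ProperClosedConvex P) {z₀ : Z}
    (hz₀ : IsOptimalSolution Set.univ (primalObjective h P M b) z₀)
    (h_cq : (Set.range (fun z : Z => M z - b) ∩ intrinsicInterior ℝ (dom P)).Nonempty) :
    ∃ y, IsKKTPoint h P M b z₀ y := by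
  obtain ⟨r, hr⟩ : ∃ r : ℝ, P (M z₀ - b) = r := by
    rcases hP.eq_coe_or_eq_top (M z₀ - b) with h' | h'
    · exact h'
    · have := hz₀.2.1
      simp [primalObjective, h'] at this
  obtain ⟨_, ⟨z₁, rfl⟩, hri⟩ := h_cq
  set g := gradient h z₀ with hg
  -- Perturbation set of the linearized problem: pairs (w, s) with s ≥ P(u) + ⟨g, z - z₀⟩ - r for
  -- some u = M z - b + w. A linear minorant over it is a multiplier.
  let D : Set (Y × ℝ) := {p | ∃ z u, p.1 = u - (M z - b) ∧
    P u ≤ ((p.2 - inner ℝ g (z - z₀) + r : ℝ) : EReal)}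
  obtain ⟨f, hf⟩ : ∃ f : Y →ₗ[ℝ] ℝ, ∀ w s, (w, s) ∈ D → f w ≤ s := by
    refine exists_linearMap_le ?_ ?_ ?_ ?_ ?_
    · rintro ⟨w, s⟩ ⟨z, u, hw, hu⟩ ⟨w', s'⟩ ⟨z', u', hw', hu'⟩ c d hc hd hcd
      refine ⟨c • z + d • z', c • u + d • u', ?_, ?_⟩
      · simp only at hw hw'
        simp only [Prod.smul_mk, Prod.mk_add_mk, hw, hw', map_add, map_smul]
        nth_rewrite 3 [← one_smul ℝ b]
        rw [← hcd]
        module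
      · have := hP.convex (x := (u, _)) hu (y := (u', _)) hu' hc hd hcd
        simp only [Set.mem_ofPred_eq, Prod.smul_mk, Prod.mk_add_mk, smul_eq_mul] at this ⊢
        convert this using 2
        have h1 : c • z + d • z' - z₀ = c • (z - z₀) + d • (z' - z₀) := by
          nth_rewrite 1 [← one_smul ℝ z₀]
          rw [← hcd]
          module
        rw [h1, inner_add_right, inner_smul_right, inner_smul_right]
        nth_rewrite 1 [← one_mul r]
        rw [← hcd]
        ring
    · exact ⟨z₀, M z₀ - b, by simp, by simp [hr]⟩
    · rintro w s s' ⟨z, u, hw, hu⟩ hs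
      refine ⟨z, u, hw, hu.trans ?_⟩
      rw [EReal.coe_le_coe_iff]
      simp only
      linarith
    · rintro s ⟨z, u, hw, hu⟩
      obtain rfl : u = M z - b := by rw [← sub_eq_zero]; exact hw.symm
      have := le_add_inner_gradient_of_isOptimalSolution h_diff h_lip hP hz₀ hr hu
      rw [← hg] at this
      simp only at this
      linarith
    -- Moving `z` and `u` slightly past `z₁` and `M z₁ - b` sends w to -εw, since the latter pair
    -- has zero residual.
    · rintro w s ⟨z, u, hw, hu⟩
      obtain ⟨ε, hε, hmem⟩ := exists_add_smul_mem_of_mem_intrinsicInterior hri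
        (show u ∈ dom P from hu.trans_lt (EReal.coe_lt_top _))
      refine ⟨ε, hε, ?_⟩
      rcases hP.eq_coe_or_eq_top (M z₁ - b - ε • (u - (M z₁ - b))) with ⟨a, ha⟩ | ha
      · refine ⟨a - r + inner ℝ g (z₁ - ε • (z - z₁) - z₀), z₁ - ε • (z - z₁),
          M z₁ - b - ε • (u - (M z₁ - b)), ?_, ?_⟩
        · simp only at hw
          simp only [hw, map_sub, map_smul]
          module
        · rw [ha, EReal.coe_le_coe_iff]
          simp only
          linarith
      · simp [dom, ha] at hmem
  set y := (InnerProductSpace.toDual ℝ Y).symm (LinearMap.toContinuousLinearMap f) with hy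
  have hyf : ∀ w, inner ℝ y w = f w := by
    intro w
    rw [hy, InnerProductSpace.toDual_symm_apply]; rfl
  refine ⟨y, ?_, r, hr, fun u => ?_⟩
  -- Shifting z₀ by -e with u fixed gives ⟨y, M e⟩ ≤ -⟨g, e⟩, that is ‖e‖² ≤ 0.
  · set e := g + ContinuousLinearMap.adjoint M y with he
    have h1 := hf (M z₀ - b - (M (z₀ - e) - b)) (inner ℝ g (z₀ - e - z₀))
      ⟨z₀ - e, M z₀ - b, rfl, by simp [hr]⟩
    rw [← hyf, sub_sub_sub_cancel_right, ← map_sub, sub_sub_cancel, sub_sub_cancel_left,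
      inner_neg_right, ← ContinuousLinearMap.adjoint_inner_left] at h1
    have h2 : inner ℝ e e ≤ (0 : ℝ) := by
      nth_rewrite 1 [he]
      rw [inner_add_left]; linarith
    rw [real_inner_self_eq_norm_sq] at h2
    exact norm_eq_zero.1 (sq_eq_zero_iff.1 (le_antisymm h2 (sq_nonneg _)))
  · rcases hP.eq_coe_or_eq_top u with ⟨a, ha⟩ | ha
    · have h1 := hf (u - (M z₀ - b)) (a - r) ⟨z₀, u, rfl, by simp [ha]⟩
      rw [← hyf] at h1
      rw [ha, EReal.coe_le_coe_iff]
      linarith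
    · rw [ha]; exact le_top

end Optimality

/-! ### The Lyapunov function and the stepsize condition. -/

section Convergence

variable {Z Y : Type*}
  [NormedAddCommGroup Z] [InnerProductSpace ℝ Z] [CompleteSpace Z]
  [NormedAddCommGroup Y] [InnerProductSpace ℝ Y] [CompleteSpace Y]

theorem inner_proxTerm (M : Z →L[ℝ] Y) (β τ : ℝ) (v w : Y) :
    inner ℝ (proxTerm M β τ v) w = τ * inner ℝ v w -
      β * inner ℝ (ContinuousLinearMap.adjoint M v) (ContinuousLinearMap.adjoint M w) := by
  simp [proxTerm, inner_sub_left, real_inner_smul_left, ContinuousLinearMap.adjoint_inner_right]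

/-- The quadratic form of `proxTerm`. -/
def proxForm (M : Z →L[ℝ] Y) (β τ : ℝ) (w : Y) : ℝ :=
  τ * ‖w‖ ^ 2 - β * ‖ContinuousLinearMap.adjoint M w‖ ^ 2

theorem proxForm_nonneg {M : Z →L[ℝ] Y} {β τ : ℝ} (hβ : 0 ≤ β)
    (hτ : β * ‖ContinuousLinearMap.adjoint M ∘L M‖ ≤ τ) (w : Y) : 0 ≤ proxForm M β τ w := by
  rw [ContinuousLinearMap.norm_adjoint_comp_self] at hτ
  have h1 : ‖ContinuousLinearMap.adjoint M w‖ ≤ ‖M‖ * ‖w‖ := by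
    have := (ContinuousLinearMap.adjoint M).le_opNorm w
    rwa [LinearIsometryEquiv.norm_map] at this
  have h2 : ‖ContinuousLinearMap.adjoint M w‖ ^ 2 ≤ (‖M‖ * ‖w‖) ^ 2 := by gcongr
  have h3 := mul_le_mul_of_nonneg_left h2 hβ
  have h4 := mul_le_mul_of_nonneg_right hτ (sq_nonneg ‖w‖)
  rw [proxForm]
  nlinarith

theorem inner_proxTerm_sub (M : Z →L[ℝ] Y) (β τ : ℝ) (v w : Y) :
    inner ℝ (proxTerm M β τ (v - w)) w =
      1 / 2 * (proxForm M β τ v - proxForm M β τ w - proxForm M β τ (v - w)) := by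
  rw [inner_proxTerm, proxForm, proxForm, proxForm, map_sub, norm_sub_sq_real, norm_sub_sq_real,
    inner_sub_left, inner_sub_left, real_inner_self_eq_norm_sq, real_inner_self_eq_norm_sq]
  ring

/-- The Lyapunov function of the algorithm. -/
def lyapunov (M : Z →L[ℝ] Y) (β γ τ : ℝ) (e : Z) (w : Y) : ℝ :=
  1 / (2 * (γ * β)) * ‖e‖ ^ 2 + 1 / 2 * proxForm M β τ w

theorem lyapunov_nonneg {M : Z →L[ℝ] Y} {β γ τ : ℝ} (hβ : 0 < β) (hγ : 0 < γ)
    (hτ : β * ‖ContinuousLinearMap.adjoint M ∘L M‖ ≤ τ) (e : Z) (w : Y) :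
    0 ≤ lyapunov M β γ τ e w := by
  have := proxForm_nonneg hβ.le hτ w
  rw [lyapunov]; positivity

/-- A positive definite binary quadratic form dominates a multiple of the sum of squares. -/
theorem exists_pos_mul_le_of_discrim {a k β : ℝ} (ha : 0 < a) (hk : 0 < k)
    (hd : β ^ 2 < 4 * a * k) :
    ∃ c > 0, ∀ r d : ℝ, c * (r ^ 2 + d ^ 2) ≤ a * r ^ 2 + k * d ^ 2 - β * (r * d) := by
  -- With this `c`, 4(a - c)(k - c) - β² = 4c², so the form stays positive after subtracting c(r² +
  -- d²).
  set c := (4 * a * k - β ^ 2) / (4 * (a + k)) with hc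
  have hak : 0 < 4 * (a + k) := by positivity
  have hc0 : 0 < c := div_pos (by linarith) hak
  have hc1 : c * (4 * (a + k)) = 4 * a * k - β ^ 2 := by
    rw [hc]; exact div_mul_cancel₀ _ hak.ne'
  have hca : 0 < a - c := by
    by_contra hcon
    nlinarith [sq_nonneg β, mul_pos ha ha]
  refine ⟨c, hc0, fun r d => ?_⟩
  have h1 : 0 ≤ 4 * (a - c) * (a * r ^ 2 + k * d ^ 2 - β * (r * d) - c * (r ^ 2 + d ^ 2)) := by
    have : 4 * (a - c) * (a * r ^ 2 + k * d ^ 2 - β * (r * d) - c * (r ^ 2 + d ^ 2)) =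
        (2 * (a - c) * r - β * d) ^ 2 + 4 * c ^ 2 * d ^ 2 +
          ((4 * a * k - β ^ 2) - c * (4 * (a + k))) * d ^ 2 := by ring
    rw [this, hc1]
    nlinarith [sq_nonneg (2 * (a - c) * r - β * d), sq_nonneg (c * d)]
  have h2 := nonneg_of_mul_nonneg_right h1 (by linarith)
  linarith

/-- Here `e`, `v`, `w` are the errors of z^t, y^t, y^{t+1}. As M* w = r - d, `hmono` contains ⟨e -
βr, r - d⟩: its ⟨e, r⟩ cancels against the expansion of ‖e - γβr‖², cocoercivity bounds ⟨e, d⟩ and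
Cauchy–Schwarz bounds ⟨r, d⟩. -/
theorem lyapunov_decrease {M : Z →L[ℝ] Y} {β γ τ L : ℝ} (hβ : 0 < β) (hγ : 0 < γ) (hL : 0 < L)
    {e d r : Z} {v w : Y} (hr : r = d + ContinuousLinearMap.adjoint M w)
    (hmono : 0 ≤ inner ℝ (M (e - β • r) + proxTerm M β τ (v - w)) w)
    (hcoco : ‖d‖ ^ 2 ≤ L * inner ℝ d e) :
    lyapunov M β γ τ (e - (γ * β) • r) w + 1 / 2 * proxForm M β τ (v - w) +
      (β * (1 - γ / 2) * ‖r‖ ^ 2 + 1 / L * ‖d‖ ^ 2 - β * (‖r‖ * ‖d‖)) ≤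
      lyapunov M β γ τ e v := by
  have hw : ContinuousLinearMap.adjoint M w = r - d := by rw [hr]; abel
  rw [inner_add_left, inner_proxTerm_sub, ← ContinuousLinearMap.adjoint_inner_right, hw,
    inner_sub_left, inner_sub_right, inner_sub_right, real_inner_smul_left,
    real_inner_smul_left, real_inner_self_eq_norm_sq] at hmono
  have h1 : 1 / L * ‖d‖ ^ 2 ≤ inner ℝ e d := by
    rw [real_inner_comm, one_div, inv_mul_le_iff₀ hL]; exact hcoco
  have h2 := real_inner_le_norm r d
  have h3 : 1 / (2 * (γ * β)) * ‖e - (γ * β) • r‖ ^ 2 =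
      1 / (2 * (γ * β)) * ‖e‖ ^ 2 - inner ℝ e r + γ * β / 2 * ‖r‖ ^ 2 := by
    rw [norm_sub_sq_real, inner_smul_right, norm_smul, mul_pow, Real.norm_eq_abs, sq_abs]
    field_simp
  rw [lyapunov, lyapunov, h3]
  nlinarith [mul_le_mul_of_nonneg_left h2 hβ.le]

/-- The discriminant condition is γ < 2 - βL/2. For βL ≤ 1 it follows from γ < 3/2; for 1 ≤ βL < 2
from γ < 1/2 + 1/(βL), because (βL - 1)(βL - 2) ≤ 0. -/
theorem sq_lt_of_stepsize {β γ L : ℝ} (hL : 0 < L) (hβ : β ∈ Set.Ioo 0 (2 / L))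
    (hγ : γ ∈ Set.Ioo 0 (1 + min (1 / 2) (1 / (β * L) - 1 / 2))) :
    0 < β * (1 - γ / 2) ∧ β ^ 2 < 4 * (β * (1 - γ / 2)) * (1 / L) := by
  obtain ⟨hβ0, hβ2⟩ := hβ
  obtain ⟨-, hγ1⟩ := hγ
  have hs0 : 0 < β * L := mul_pos hβ0 hL
  have hs2 : β * L < 2 := by rwa [lt_div_iff₀ hL] at hβ2
  have h1 := min_le_left (1 / 2 : ℝ) (1 / (β * L) - 1 / 2)
  have h2 := min_le_right (1 / 2 : ℝ) (1 / (β * L) - 1 / 2)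
  have h3 : γ < 2 - β * L / 2 := by
    rcases le_total (β * L) 1 with h | h
    · linarith
    · have h4 : 1 / (β * L) ≤ 3 / 2 - β * L / 2 := by
        rw [div_le_iff₀ hs0]; nlinarith
      linarith
  have h5 : 0 < 1 - γ / 2 := by linarith
  refine ⟨mul_pos hβ0 h5, ?_⟩
  rw [mul_one_div, lt_div_iff₀ hL]
  nlinarith

theorem tendsto_zero_of_lyapunov {Φ q : ℕ → ℝ} (hΦ : ∀ t, 0 ≤ Φ t) (hq : ∀ t, 0 ≤ q t)
    (hstep : ∀ t, Φ (t + 1) + q t ≤ Φ t) : Tendsto q atTop (𝓝 0) := by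
  have hanti : Antitone Φ := antitone_nat_of_succ_le fun t => by linarith [hstep t, hq t]
  have h1 := tendsto_atTop_ciInf hanti ⟨0, by rintro _ ⟨t, rfl⟩; exact hΦ t⟩
  have h2 := h1.sub ((tendsto_add_atTop_iff_nat 1).2 h1)
  rw [sub_self] at h2
  exact squeeze_zero hq (fun t => by linarith [hstep t]) h2

end Convergence

/-! ### Convergence of the iterates. -/

section Algorithm

variable {Z Y : Type*}
  [NormedAddCommGroup Z] [InnerProductSpace ℝ Z] [CompleteSpace Z]
  [NormedAddCommGroup Y] [InnerProductSpace ℝ Y] [CompleteSpace Y]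
  {h : Z → ℝ} {P : Y → EReal} {M : Z →L[ℝ] Y} {b : Y} {β γ τ : ℝ} {y : ℕ → Y} {z : ℕ → Z}

/-- The -βMM* in `proxTerm` regroups the explicit z^t - β∇h(z^t) into z^t - βr, so the residual `r`
that drives the z-update also appears here. -/
theorem IsPPGSequence.hasSubgradientAt [FiniteDimensional ℝ Y]
    (hs : IsPPGSequence h P M b β γ τ y z) (hP : ProperClosedConvex P) (hτ : 0 < τ)
    {z₀ : Z} {y₀ : Y} (hk : IsKKTPoint h P M b z₀ y₀) (t : ℕ) :
    HasSubgradientAt (conj P)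
      (M (z t - β • (gradient h (z t) + ContinuousLinearMap.adjoint M (y (t + 1)))) - b +
        proxTerm M β τ (y t - y (t + 1))) (y (t + 1)) := by
  have hk' := hk.subgradient.conj
  have hconj : ProperClosedConvex (conj P) := hP.conj <| by
    obtain ⟨r, hr, -⟩ := hk'
    exact ⟨y₀, by rw [dom, Set.mem_ofPred_eq, hr]; exact EReal.coe_lt_top _⟩
  have := hconj.hasSubgradientAt_prox hk' hτ
    (τ⁻¹ • (proxTerm M β τ (y t) - b + M (z t) - β • M (gradient h (z t))))
  rw [← hs.y_update t, smul_sub, smul_inv_smul₀ hτ.ne'] at this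
  convert this using 1
  simp only [proxTerm, map_sub, map_add, map_smul, _root_.sub_apply,
    _root_.smul_apply, ContinuousLinearMap.id_apply,
    ContinuousLinearMap.comp_apply]
  module

theorem IsPPGSequence.lyapunov_step [FiniteDimensional ℝ Y] {L : ℝ} (hL : 0 < L)
    (h_convex : ConvexOn ℝ Set.univ h) (h_diff : Differentiable ℝ h)
    (h_lip : ∀ z₁ z₂ : Z, ‖gradient h z₁ - gradient h z₂‖ ≤ L * ‖z₁ - z₂‖)
    (hs : IsPPGSequence h P M b β γ τ y z) (hP : ProperClosedConvex P) (hβ : 0 < β) (hγ : 0 < γ)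
    (hτ : 0 < τ) {z₀ : Z} {y₀ : Y} (hk : IsKKTPoint h P M b z₀ y₀) (t : ℕ) :
    lyapunov M β γ τ (z (t + 1) - z₀) (y (t + 1) - y₀) +
        1 / 2 * proxForm M β τ (y t - y (t + 1)) +
        (β * (1 - γ / 2) *
            ‖gradient h (z t) + ContinuousLinearMap.adjoint M (y (t + 1))‖ ^ 2 +
          1 / L * ‖gradient h (z t) - gradient h z₀‖ ^ 2 -
          β * (‖gradient h (z t) + ContinuousLinearMap.adjoint M (y (t + 1))‖ *
            ‖gradient h (z t) - gradient h z₀‖)) ≤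
      lyapunov M β γ τ (z t - z₀) (y t - y₀) := by
  set r := gradient h (z t) + ContinuousLinearMap.adjoint M (y (t + 1)) with hr
  have hr' : r = gradient h (z t) - gradient h z₀ +
      ContinuousLinearMap.adjoint M (y (t + 1) - y₀) := by
    rw [hr, map_sub, ← sub_zero (gradient h (z t) + _), ← hk.gradient_add]; abel
  have hmono := (hs.hasSubgradientAt hP hτ hk t).inner_sub_nonneg hk.subgradient.conj
  rw [← hr] at hmono
  have h1 : M (z t - β • r) - b + proxTerm M β τ (y t - y (t + 1)) - (M z₀ - b) =
      M (z t - z₀ - β • r) + proxTerm M β τ ((y t - y₀) - (y (t + 1) - y₀)) := by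
    rw [sub_sub_sub_cancel_right]
    simp only [map_sub]
    abel
  rw [h1] at hmono
  have := lyapunov_decrease hβ hγ hL hr' hmono
    (norm_gradient_sub_sq_le hL h_convex h_diff h_lip (z t) z₀)
  rwa [sub_sub_sub_cancel_right, sub_right_comm, ← hs.z_update t] at this

/-- The primal-dual iterates converge to a Karush–Kuhn–Tucker point. -/
theorem IsPPGSequence.exists_tendsto_isKKTPoint [FiniteDimensional ℝ Z] [FiniteDimensional ℝ Y]
    {L : ℝ} (hL : 0 < L)
    (h_convex : ConvexOn ℝ Set.univ h) (h_diff : Differentiable ℝ h)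
    (h_lip : ∀ z₁ z₂ : Z, ‖gradient h z₁ - gradient h z₂‖ ≤ L * ‖z₁ - z₂‖)
    (hs : IsPPGSequence h P M b β γ τ y z) (hP : ProperClosedConvex P)
    (hβ : β ∈ Set.Ioo 0 (2 / L))
    (hγ : γ ∈ Set.Ioo 0 (1 + min (1 / 2) (1 / (β * L) - 1 / 2)))
    (hτ : β * ‖ContinuousLinearMap.adjoint M ∘L M‖ ≤ τ) (hM : M ≠ 0)
    {z₀ : Z} {y₀ : Y} (hk₀ : IsKKTPoint h P M b z₀ y₀) :
    ∃ zbar ybar, IsKKTPoint h P M b zbar ybar ∧ Tendsto z atTop (𝓝 zbar) ∧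
      Tendsto y atTop (𝓝 ybar) := by
  have hβ0 : 0 < β := hβ.1
  have hγ0 : 0 < γ := hγ.1
  have hτ0 : 0 < τ := by
    refine lt_of_lt_of_le (mul_pos hβ0 ?_) hτ
    rw [ContinuousLinearMap.norm_adjoint_comp_self]
    exact mul_pos (norm_pos_iff.2 hM) (norm_pos_iff.2 hM)
  obtain ⟨ha, hdisc⟩ := sq_lt_of_stepsize hL hβ hγ
  obtain ⟨c, hc, hquad⟩ := exists_pos_mul_le_of_discrim ha (one_div_pos.2 hL) hdisc
  set A := ContinuousLinearMap.adjoint M with hA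
  set r : ℕ → Z := fun t => gradient h (z t) + A (y (t + 1)) with hr
  have hgc : Continuous (gradient h) :=
    (LipschitzWith.of_dist_le_mul (K := L.toNNReal) fun u v => by
      simpa [dist_eq_norm, hL.le] using h_lip u v).continuous
  have hstep : ∀ {z' y'}, IsKKTPoint h P M b z' y' → ∀ t,
      lyapunov M β γ τ (z (t + 1) - z') (y (t + 1) - y') +
        (1 / 2 * proxForm M β τ (y t - y (t + 1)) +
          c * (‖r t‖ ^ 2 + ‖gradient h (z t) - gradient h z'‖ ^ 2)) ≤
      lyapunov M β γ τ (z t - z') (y t - y') := by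
    intro z' y' hk t
    have h1 := hs.lyapunov_step hL h_convex h_diff h_lip hP hβ0 hγ0 hτ0 hk t
    have h2 := hquad ‖r t‖ ‖gradient h (z t) - gradient h z'‖
    linarith
  have hq0 : ∀ z' t, 0 ≤ c * (‖r t‖ ^ 2 + ‖gradient h (z t) - gradient h z'‖ ^ 2) :=
    fun z' t => by positivity
  have hp0 := proxForm_nonneg hβ0.le hτ
  have hanti : ∀ {z' y'}, IsKKTPoint h P M b z' y' →
      Antitone fun t => lyapunov M β γ τ (z t - z') (y t - y') := fun {z' y'} hk =>
    antitone_nat_of_succ_le fun t => by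
      linarith [hstep hk t, hq0 z' t, hp0 (y t - y (t + 1))]
  have hlim : Tendsto (fun t => 1 / 2 * proxForm M β τ (y t - y (t + 1)) +
      c * (‖r t‖ ^ 2 + ‖gradient h (z t) - gradient h z₀‖ ^ 2)) atTop (𝓝 0) :=
    tendsto_zero_of_lyapunov (Φ := fun t => lyapunov M β γ τ (z t - z₀) (y t - y₀))
      (fun t => lyapunov_nonneg hβ0 hγ0 hτ _ _)
      (fun t => by linarith [hq0 z₀ t, hp0 (y t - y (t + 1))]) (hstep hk₀)
  have hr0 : Tendsto r atTop (𝓝 0) := by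
    have h1 : Tendsto (fun t => ‖r t‖ ^ 2) atTop (𝓝 0) := by
      have h2 := hlim.const_mul c⁻¹
      rw [mul_zero] at h2
      refine squeeze_zero (fun t => sq_nonneg _) (fun t => ?_) h2
      rw [le_inv_mul_iff₀ hc]
      nlinarith [hp0 (y t - y (t + 1)), sq_nonneg ‖gradient h (z t) - gradient h z₀‖]
    rw [tendsto_zero_iff_norm_tendsto_zero]
    simpa using h1.sqrt
  have hd0 : Tendsto (fun t => gradient h (z t) - gradient h z₀) atTop (𝓝 0) := by
    have h1 : Tendsto (fun t => ‖gradient h (z t) - gradient h z₀‖ ^ 2) atTop (𝓝 0) := by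
      have h2 := hlim.const_mul c⁻¹
      rw [mul_zero] at h2
      refine squeeze_zero (fun t => sq_nonneg _) (fun t => ?_) h2
      rw [le_inv_mul_iff₀ hc]
      nlinarith [hp0 (y t - y (t + 1)), sq_nonneg ‖r t‖]
    rw [tendsto_zero_iff_norm_tendsto_zero]
    simpa using h1.sqrt
  have hp : Tendsto (fun t => proxForm M β τ (y t - y (t + 1))) atTop (𝓝 0) := by
    have h2 := hlim.const_mul 2
    rw [mul_zero] at h2
    exact squeeze_zero (fun t => hp0 _) (fun t => by linarith [hq0 z₀ t]) h2
  -- A y^{t+1} - A y₀ is the residual minus the gradient error; both vanish.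
  have hAy : Tendsto (fun t => A (y t)) atTop (𝓝 (A y₀)) := by
    rw [← tendsto_add_atTop_iff_nat 1]
    have h1 := (hr0.sub hd0).add_const (A y₀)
    rw [sub_zero, zero_add] at h1
    refine h1.congr fun t => ?_
    simp only [hr]
    rw [← sub_zero (_ + A y₀), ← hk₀.gradient_add]
    abel
  -- `proxTerm` may be singular, so its form alone does not control y; the separately known A y^t
  -- supplies the rest.
  have hnorm : ∀ w, ‖w‖ ^ 2 = τ⁻¹ * (proxForm M β τ w + β * ‖A w‖ ^ 2) := by
    intro w
    rw [proxForm, sub_add_cancel, inv_mul_cancel_left₀ hτ0.ne']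
  have hΔ : Tendsto (fun t => y t - y (t + 1)) atTop (𝓝 0) := by
    have h1 : Tendsto (fun t => A (y t - y (t + 1))) atTop (𝓝 0) := by
      have := hAy.sub ((tendsto_add_atTop_iff_nat 1).2 hAy)
      simpa using this
    have h2 : Tendsto (fun t => ‖y t - y (t + 1)‖ ^ 2) atTop (𝓝 0) := by
      simp_rw [hnorm]
      simpa using (hp.add ((h1.norm.pow 2).const_mul β)).const_mul τ⁻¹
    rw [tendsto_zero_iff_norm_tendsto_zero]
    simpa using h2.sqrt
  have hΦle : ∀ t, lyapunov M β γ τ (z t - z₀) (y t - y₀) ≤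
      lyapunov M β γ τ (z 0 - z₀) (y 0 - y₀) := fun t => hanti hk₀ (Nat.zero_le t)
  set Φ₀ := lyapunov M β γ τ (z 0 - z₀) (y 0 - y₀) with hΦ₀
  obtain ⟨B, hB⟩ : ∃ B, ∀ t, ‖A (y t - y₀)‖ ≤ B := by
    have := (hAy.sub_const (A y₀)).norm.bddAbove_range
    obtain ⟨B, hB⟩ := this
    exact ⟨B, fun t => by rw [map_sub]; exact hB ⟨t, rfl⟩⟩
  have hbz : Bornology.IsBounded (Set.range z) := by
    refine (Metric.isBounded_closedBall (x := z₀)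
      (r := Real.sqrt (2 * (γ * β) * Φ₀))).subset ?_
    rintro _ ⟨t, rfl⟩
    rw [mem_closedBall_iff_norm]
    refine Real.le_sqrt_of_sq_le ?_
    have h1 := hΦle t
    have h2 := hp0 (y t - y₀)
    rw [lyapunov] at h1
    have h3 : 1 / (2 * (γ * β)) * ‖z t - z₀‖ ^ 2 ≤ Φ₀ := by linarith
    rwa [one_div, inv_mul_le_iff₀ (by positivity)] at h3
  have hby : Bornology.IsBounded (Set.range y) := by
    refine (Metric.isBounded_closedBall (x := y₀)
      (r := Real.sqrt (τ⁻¹ * (2 * Φ₀ + β * B ^ 2)))).subset ?_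
    rintro _ ⟨t, rfl⟩
    rw [mem_closedBall_iff_norm]
    refine Real.le_sqrt_of_sq_le ?_
    rw [hnorm]
    have h1 := hΦle t
    rw [lyapunov] at h1
    have h2 : 0 ≤ 1 / (2 * (γ * β)) * ‖z t - z₀‖ ^ 2 := by positivity
    have h3 : proxForm M β τ (y t - y₀) ≤ 2 * Φ₀ := by linarith
    have h4 := hB t
    gcongr
  obtain ⟨⟨zbar, ybar⟩, -, φ, hφ, hlimφ⟩ := tendsto_subseq_of_bounded (hbz.prod hby)
    (x := fun t => (z t, y t)) fun t => ⟨⟨t, rfl⟩, ⟨t, rfl⟩⟩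
  rw [Prod.tendsto_iff] at hlimφ
  obtain ⟨hzφ, hyφ⟩ := hlimφ
  simp only [Function.comp_apply] at hzφ hyφ
  have hφt := hφ.tendsto_atTop
  -- The proximal inclusion at step `φ n` is based at `y (φ n + 1)`, so the shifted subsequence must
  -- have the same limit.
  have hyφ1 : Tendsto (fun n => y (φ n + 1)) atTop (𝓝 ybar) := by
    have := hyφ.sub (hΔ.comp hφt)
    simpa [Function.comp_def] using this
  have hk : IsKKTPoint h P M b zbar ybar := by
    constructor
    · have h1 : Tendsto (fun n => r (φ n)) atTop (𝓝 (gradient h zbar + A ybar)) :=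
        ((hgc.tendsto _).comp hzφ).add ((A.continuous.tendsto _).comp hyφ1)
      exact tendsto_nhds_unique h1 (hr0.comp hφt)
    · have hk' := hk₀.subgradient.conj
      have hconj : ProperClosedConvex (conj P) := hP.conj <| by
        obtain ⟨r, hr, -⟩ := hk'
        exact ⟨y₀, by rw [dom, Set.mem_ofPred_eq, hr]; exact EReal.coe_lt_top _⟩
      refine hP.hasSubgradientAt_of_conj (hconj.hasSubgradientAt_of_tendsto ?_ hyφ1
        fun n => hs.hasSubgradientAt hP hτ0 hk₀ (φ n))
      have h1 : Tendsto (fun n => z (φ n) - β • r (φ n)) atTop (𝓝 zbar) := by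
        simpa using hzφ.sub ((hr0.comp hφt).const_smul β)
      have h2 : Tendsto (fun n => proxTerm M β τ (y (φ n) - y (φ n + 1))) atTop (𝓝 0) := by
        have := ((proxTerm M β τ).continuous.tendsto 0).comp (hΔ.comp hφt)
        rwa [map_zero] at this
      have h3 := (((M.continuous.tendsto _).comp h1).sub_const b).add h2
      rwa [add_zero] at h3
  -- Recentred at the cluster point, the Lyapunov function converges by monotonicity, and the
  -- subsequence identifies its limit as 0.
  have hΦ0 : Tendsto (fun t => lyapunov M β γ τ (z t - zbar) (y t - ybar)) atTop (𝓝 0) := by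
    have h1 := tendsto_atTop_ciInf (hanti hk)
      ⟨0, by rintro _ ⟨t, rfl⟩; exact lyapunov_nonneg hβ0 hγ0 hτ _ _⟩
    have h2 : Tendsto (fun n => lyapunov M β γ τ (z (φ n) - zbar) (y (φ n) - ybar)) atTop
        (𝓝 0) := by
      have hcont : Continuous fun p : Z × Y => lyapunov M β γ τ (p.1 - zbar) (p.2 - ybar) := by
        unfold lyapunov proxForm
        fun_prop
      have := (hcont.tendsto (zbar, ybar)).comp (hzφ.prodMk_nhds hyφ)
      simpa [lyapunov, proxForm, Function.comp_def] using this
    rwa [tendsto_nhds_unique (h1.comp hφt) h2] at h1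
  refine ⟨zbar, ybar, hk, ?_, ?_⟩
  · rw [← tendsto_sub_nhds_zero_iff, tendsto_zero_iff_norm_tendsto_zero]
    have h1 : Tendsto (fun t => ‖z t - zbar‖ ^ 2) atTop (𝓝 0) := by
      have h2 := hΦ0.const_mul (2 * (γ * β))
      rw [mul_zero] at h2
      refine squeeze_zero (fun t => sq_nonneg _) (fun t => ?_) h2
      rw [← inv_mul_le_iff₀ (by positivity), ← one_div, lyapunov]
      linarith [hp0 (y t - ybar)]
    simpa using h1.sqrt
  · rw [← tendsto_sub_nhds_zero_iff, tendsto_zero_iff_norm_tendsto_zero]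
    have h1 : Tendsto (fun t => proxForm M β τ (y t - ybar)) atTop (𝓝 0) := by
      have h2 := hΦ0.const_mul 2
      rw [mul_zero] at h2
      refine squeeze_zero (fun t => hp0 _) (fun t => ?_) h2
      have h3 : 0 ≤ 1 / (2 * (γ * β)) * ‖z t - zbar‖ ^ 2 := by positivity
      rw [lyapunov]
      linarith
    have hAeq : A y₀ = A ybar :=
      tendsto_nhds_unique (hAy.comp hφt) ((A.continuous.tendsto _).comp hyφ)
    have h2 : Tendsto (fun t => A (y t - ybar)) atTop (𝓝 0) := by
      have := hAy.sub_const (A ybar)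
      rw [hAeq, sub_self] at this
      simpa using this
    have h3 : Tendsto (fun t => ‖y t - ybar‖ ^ 2) atTop (𝓝 0) := by
      simp_rw [hnorm]
      simpa using (h1.add ((h2.norm.pow 2).const_mul β)).const_mul τ⁻¹
    simpa using h3.sqrt

end Algorithm

end PPG

end

theorem theorem4p1 {Z Y : Type*}
    [NormedAddCommGroup Z] [InnerProductSpace ℝ Z] [CompleteSpace Z] [FiniteDimensional ℝ Z]
    [NormedAddCommGroup Y] [InnerProductSpace ℝ Y] [CompleteSpace Y] [FiniteDimensional ℝ Y]
    (h : Z → ℝ) (P : Y → EReal) (M : Z →L[ℝ] Y) (b : Y) (L : ℝ)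
    (hL : 0 < L)
    (h_convex : ConvexOn ℝ Set.univ h)
    (h_diff : Differentiable ℝ h)
    (h_lip : ∀ z₁ z₂ : Z, ‖gradient h z₁ - gradient h z₂‖ ≤ L * ‖z₁ - z₂‖)
    (hP : PPG.ProperClosedConvex P)
    (hM : M ≠ 0)
    (h_opt : ∃ z : Z, PPG.IsOptimalSolution Set.univ (PPG.primalObjective h P M b) z)
    (h_cq : (Set.range (fun z : Z => M z - b) ∩ intrinsicInterior ℝ (PPG.dom P)).Nonempty)
    (β γ τ : ℝ)
    (hβ : β ∈ Set.Ioo 0 (2 / L))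
    (hγ : γ ∈ Set.Ioo 0 (1 + min (1 / 2) (1 / (β * L) - 1 / 2)))
    (hτ : β * ‖ContinuousLinearMap.adjoint M ∘L M‖ ≤ τ)
    (x : ℕ → Z) (y : ℕ → Y) (z : ℕ → Z)
    (h_ppg : PPG.IsPPGSequence h P M b β γ τ y z)
    (hx : ∀ t, x (t + 1) = gradient h (z t)) :
    (∃ p : Z × Y,
      PPG.IsOptimalSolution (PPG.dualFeasible M) (PPG.dualObjective h P b) p ∧
        Tendsto (fun t => (x t, y t)) atTop (𝓝 p)) ∧
    (∃ zbar : Z,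
      PPG.IsOptimalSolution Set.univ (PPG.primalObjective h P M b) zbar ∧
        Tendsto z atTop (𝓝 zbar)) := by
  obtain ⟨z₀, hz₀⟩ := h_opt
  obtain ⟨y₀, hk₀⟩ := PPG.exists_isKKTPoint h_diff h_lip hP hz₀ h_cq
  obtain ⟨zbar, ybar, hk, hz, hy⟩ := h_ppg.exists_tendsto_isKKTPoint hL h_convex h_diff h_lip hP
    hβ hγ hτ hM hk₀
  refine ⟨⟨_, hk.isOptimalSolution_dual h_convex h_diff, Tendsto.prodMk_nhds ?_ hy⟩,
    zbar, hk.isOptimalSolution_primal h_convex h_diff, hz⟩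
  -- `x 0` is unconstrained, so only the shifted sequence equals ∇h(z^t).
  rw [← tendsto_add_atTop_iff_nat 1]
  simp_rw [hx]
  have hgc : Continuous (gradient h) :=
    (LipschitzWith.of_dist_le_mul (K := L.toNNReal) fun u v => by
      simpa [dist_eq_norm, hL.le] using h_lip u v).continuous
  exact (hgc.tendsto _).comp hz
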